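/- There are absolute constants $C>0$ and $\varepsilon\in(0,1)$ such that for every $n\ge 1$, with $d=2^n$, there are a number of copies $T\le C\,2^{n/2}$ and a classical test $A:\{1,\dots,d\}^T\to\{\text{mixed},\text{pure}\}$ with the following two properties. (1) $A$ is an $L_2$ uniformity tester: for every probability distribution $q$ on $\{1,\dots,d\}$ and i.i.d. samples $x_1,\dots,x_T\sim q$, the output $A(x_1,\dots,x_T)$ is "mixed" with probability at least $9/10$ if $q$ is the uniform distribution $u$, and is "pure" with probability at least $9/10$ if $\|q-u\|_2\ge \varepsilon/\sqrt d$. (2) Consider the following learning algorithm without quantum memory for an unknown $n$-qubit state $\rho$: draw one unitary $U$ from the Haar probability measure on $U(d)$, measure each of $T$ copies of $\rho$ separately in the orthonormal basis $\{U|i\rangle\}_{i=1}^{d}$, obtaining outcomes $x_1,\dots,x_T$, and output $A(x_1,\dots,x_T)$. This algorithm distinguishes pure states from the maximally mixed state: it outputs "mixed" with probability at least $4/5$ if $\rho=\mathbb 1/2^n$, and for every pure state $\rho=|\psi\rangle\langle\psi|$ it outputs "pure" with probability at least $4/5$; here the probability is over $U$ and all measurement outcomes. Here a learning algorithm without quantum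 memory using $T$ copies measures one copy of $\rho$ at a time, each with a POVM that may depend on classical randomness drawn at the start and on all earlier outcomes (a POVM $\{F_s\}_s$ on $\rho$ gives outcome $s$ with probability $\mathrm{Tr}(F_s\rho)$), and then outputs an answer computed from the classical randomness and all the outcomes. -/

import Mathlib

open MeasureTheory Matrix
open scoped ComplexOrder

noncomputable section

namespace PurityTesting

/-- Operators on `n` qubits, written as matrices in the computational basis. -/
abbrev Op (n : ℕ) : Type := Matrix (Fin (2 ^ n)) (Fin (2 ^ n)) ℂ

/-- `ρ = |ψ⟩⟨ψ|` for some unit vector `ψ`. -/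
def IsPureState {n : ℕ} (ρ : Op n) : Prop :=
  ∃ ψ : EuclideanSpace ℂ (Fin (2 ^ n)), ‖ψ‖ = 1 ∧ ρ = vecMulVec (fun a => ψ a) (fun a => star (ψ a))

/-- The maximally mixed state `1 / 2 ^ n`. -/
def maximallyMixed (n : ℕ) : Op n := ((2 : ℂ) ^ n)⁻¹ • (1 : Op n)

/-- A POVM on `n` qubits with outcomes `0, …, k - 1`. -/
structure POVM (n k : ℕ) where
  elem : Fin k → Op n
  posSemidef : ∀ s, (elem s).PosSemidef
  sum_eq_one : ∑ s, elem s = 1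

/-- The Born rule: the probability `Tr (F_s ρ)` of outcome `s`. -/
def POVM.prob {n k : ℕ} (F : POVM n k) (ρ : Op n) (s : Fin k) : ℝ := ((F.elem s * ρ).trace).re

/-- An adaptive strategy without quantum memory that uses exactly `T` copies: a rooted tree of depth
`T`. At an inner node one fresh copy is measured with the POVM of that node and the outcome selects
the child, so a node is the record of all earlier outcomes. A leaf carries the final answer;
`true` means "maximally mixed" and `false` means "pure". -/
inductive LearningTree (n : ℕ) : ℕ → Type
  | leaf (answer : Bool) : LearningTree n 0
  | node {T k : ℕ} (F : POVM n k) (child : Fin k → LearningTree n T) : LearningTree n (T + 1)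

/-- The probability that the strategy answers `b` when every copy is in the state `ρ`: the sum, over
all leaves with answer `b`, of the product of the Born probabilities along the path to the leaf. -/
def LearningTree.outputProb {n : ℕ} (ρ : Op n) (b : Bool) : {T : ℕ} → LearningTree n T → ℝ
  | _, .leaf answer => if answer = b then 1 else 0
  | _, .node F child => ∑ s, F.prob ρ s * (child s).outputProb ρ b

/-- A (randomized) learning algorithm without quantum memory that uses `T` copies: classical
randomness, drawn once at the beginning, selects an adaptive strategy. -/
structure LearningAlgorithm (n T : ℕ) where
  Seed : Type
  [measurableSpace : MeasurableSpace Seed]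
  law : Measure Seed
  [isProbabilityMeasure : IsProbabilityMeasure law]
  tree : Seed → LearningTree n T
  measurable_outputProb : ∀ (ρ : Op n) (b : Bool), Measurable fun ω => (tree ω).outputProb ρ b

/-- The probability, over the classical randomness and all measurement outcomes, that the algorithm
answers `b` when every copy is in the state `ρ`. -/
def LearningAlgorithm.outputProb {n T : ℕ} (A : LearningAlgorithm n T) (ρ : Op n) (b : Bool) : ℝ :=
  letI := A.measurableSpace
  ∫ ω, (A.tree ω).outputProb ρ b ∂A.law

/-- On the promise that the state is maximally mixed or pure, the algorithm answers correctly with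
probability at least `p`, whatever the state is. -/
def LearningAlgorithm.DistinguishesPureFromMixed {n T : ℕ} (A : LearningAlgorithm n T) (p : ℝ) :
    Prop :=
  p ≤ A.outputProb (maximallyMixed n) true ∧ ∀ ρ : Op n, IsPureState ρ → p ≤ A.outputProb ρ false

/-! ### Haar measure on the unitary group -/

instance (d : ℕ) : MeasurableSpace (unitaryGroup (Fin d) ℂ) := borel _

instance (d : ℕ) : BorelSpace (unitaryGroup (Fin d) ℂ) := ⟨rfl⟩

instance (d : ℕ) : CompactSpace (unitaryGroup (Fin d) ℂ) := by
  refine isCompact_iff_compactSpace.mp ?_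
  have hK : IsCompact (Set.univ.pi fun _ : Fin d => Set.univ.pi fun _ : Fin d =>
      Metric.closedBall (0 : ℂ) 1) :=
    isCompact_univ_pi fun _ => isCompact_univ_pi fun _ => isCompact_closedBall _ _
  refine IsCompact.of_isClosed_subset (s := (show Set (Matrix (Fin d) (Fin d) ℂ) from
    Set.univ.pi fun _ : Fin d => Set.univ.pi fun _ : Fin d => Metric.closedBall (0 : ℂ) 1)) hK ?_ ?_
  · have : ((unitaryGroup (Fin d) ℂ : Submonoid (Matrix (Fin d) (Fin d) ℂ)) :
        Set (Matrix (Fin d) (Fin d) ℂ)) = {U | U * star U = 1} := by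
      ext U
      exact mem_unitaryGroup_iff
    rw [this]
    exact isClosed_eq (by fun_prop) continuous_const
  · intro U hU i _ j _
    simpa using entry_norm_bound_of_unitary hU i j

/-- The Haar probability measure on the unitary group `U(d)`. -/
def haarUnitary (d : ℕ) : Measure (unitaryGroup (Fin d) ℂ) := Measure.haarMeasure ⊤

instance (d : ℕ) : IsProbabilityMeasure (haarUnitary d) := ⟨Measure.haarMeasure_self⟩

/-! ### Measuring every copy in one Haar-random basis -/

/-- The measurement in the orthonormal basis `U|0⟩, U|1⟩, …` formed by the columns of `U`: its
elements are the rank one projections `U|i⟩⟨i|U†`. -/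
def basisPOVM {n : ℕ} (U : unitaryGroup (Fin (2 ^ n)) ℂ) : POVM n (2 ^ n) where
  elem i := vecMulVec (fun a => (U : Op n) a i) (fun a => star ((U : Op n) a i))
  posSemidef i := posSemidef_vecMulVec_self_star _
  sum_eq_one := by
    have h : (U : Op n) * star (U : Op n) = 1 := mem_unitaryGroup_iff.mp U.2
    rw [← h]
    ext a b
    simp [Matrix.sum_apply, vecMulVec_apply, Matrix.mul_apply, star_apply]

/-- Measure each of the `T` copies in the basis `U|0⟩, U|1⟩, …` and apply the classical test to the
list of outcomes. -/
def basisTree {n : ℕ} (U : unitaryGroup (Fin (2 ^ n)) ℂ) :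
    {T : ℕ} → ((Fin T → Fin (2 ^ n)) → Bool) → LearningTree n T
  | 0, test => .leaf (test Fin.elim0)
  | _ + 1, test => .node (basisPOVM U) fun s => basisTree U fun x => test (Fin.cons s x)

theorem continuous_outputProb_basisTree {n : ℕ} (ρ : Op n) (b : Bool) :
    ∀ {T : ℕ} (test : (Fin T → Fin (2 ^ n)) → Bool),
      Continuous fun U : unitaryGroup (Fin (2 ^ n)) ℂ => (basisTree U test).outputProb ρ b := by
  intro T
  induction T with
  | zero => intro test; exact continuous_const
  | succ T ih =>
    intro test
    simp only [basisTree, LearningTree.outputProb]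
    refine continuous_finsetSum _ fun s _ => Continuous.mul ?_ (ih _)
    have hU : Continuous fun U : unitaryGroup (Fin (2 ^ n)) ℂ => (U : Op n) := continuous_subtype_val
    have he : ∀ a, Continuous fun U : unitaryGroup (Fin (2 ^ n)) ℂ => (U : Op n) a s :=
      fun a => hU.matrix_elem a s
    simp only [POVM.prob, basisPOVM, Matrix.trace, Matrix.diag, Matrix.mul_apply, vecMulVec_apply]
    exact Complex.continuous_re.comp (continuous_finsetSum _ fun a _ => continuous_finsetSum _
      fun c _ => ((he a).mul (he c).star).mul continuous_const)

/-- Draw a Haar-random unitary `U` once, measure every copy in the basis `U|0⟩, U|1⟩, …`, and answer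
according to the classical test applied to the list of outcomes. -/
def haarBasisAlgorithm {n T : ℕ} (test : (Fin T → Fin (2 ^ n)) → Bool) : LearningAlgorithm n T where
  Seed := unitaryGroup (Fin (2 ^ n)) ℂ
  law := haarUnitary (2 ^ n)
  tree U := basisTree U test
  measurable_outputProb ρ b := (continuous_outputProb_basisTree ρ b test).measurable

/-! ### Classical uniformity testing in `L²` -/

/-- The probability that the test answers `b` on `T` independent samples from `q`. -/
def testProb {d T : ℕ} (q : Fin d → ℝ) (test : (Fin T → Fin d) → Bool) (b : Bool) : ℝ :=
  ∑ x : Fin T → Fin d, if test x = b then ∏ t, q (x t) else 0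

/-- From `T` samples of a distribution `q` on `d` points the test distinguishes, with probability at
least `9 / 10`, whether `q` is uniform (answer `true`) or at `L²` distance at least `ε / √d` from
uniform (answer `false`). -/
def IsL2UniformityTester {d T : ℕ} (ε : ℝ) (test : (Fin T → Fin d) → Bool) : Prop :=
  9 / 10 ≤ testProb (fun _ => 1 / (d : ℝ)) test true ∧
    ∀ q ∈ stdSimplex ℝ (Fin d),
      ε / √(d : ℝ) ≤ √(∑ i, (q i - 1 / (d : ℝ)) ^ 2) → 9 / 10 ≤ testProb q test false

end PurityTesting

end

noncomputable section

namespace PurityTesting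

/-! ### Expectations over independent samples -/

/-! The classical test splits the sample into two halves of size $m$ and counts coincidences between
them. The mean is $m^2\|q\|_2^2 = m^2(1/d + \|q-u\|_2^2)$, and independence gives an exact variance
(`variance_crossCollisions`). Once $m \ge 200\,\varepsilon^{-2}\sqrt d$, Chebyshev's inequality
separates the two cases (`isL2UniformityTester_collisionTest`).

For the maximally mixed state the outcomes are uniform in every basis. For a pure state no Haar
moments are computed. By right invariance, the average over $U$ equals the average over $U V_j$ for
72 fixed block diagonal unitaries $V_j$, each acting by one $2\times 2$ rotation on all pairs of
coordinates. For a vector in $\mathbb C^2$, the imbalance of its two outcome probabilities after the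
$j$-th rotation is, up to a positive factor, a real polynomial of degree at most 4 evaluated at $j$.
It is nonzero if the vector is, so at most four rotations nearly balance the vector
(`exists_card_curveRotation_balanced_le`). Hence, for each $U$, the masses of nearly balanced pairs,
summed over $j$, are at most 4 (`sum_balancedMass_pairRotation_le`). A distribution with balanced
mass below $1/2$ is far from uniform (`sum_sq_sub_ge_of_balancedMass_lt`), so the success
probability is at least $\frac{9}{10}(1 - 2\cdot\text{mass})$. Its average over $j$ is at least
$\frac{9}{10}(1 - \frac{8}{72}) = \frac45$. -/

/-- The expectation of `f` on `m` independent samples with weights `q`. -/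
def iidExp {d m : ℕ} (q : Fin d → ℝ) (f : (Fin m → Fin d) → ℝ) : ℝ :=
  ∑ x : Fin m → Fin d, (∏ t, q (x t)) * f x

section iidExp

variable {d m : ℕ} (q : Fin d → ℝ)

theorem iidExp_add (f g : (Fin m → Fin d) → ℝ) :
    iidExp q (fun x => f x + g x) = iidExp q f + iidExp q g := by
  simp [iidExp, mul_add, Finset.sum_add_distrib]

theorem iidExp_const_mul (c : ℝ) (f : (Fin m → Fin d) → ℝ) :
    iidExp q (fun x => c * f x) = c * iidExp q f := by
  simp only [iidExp, Finset.mul_sum]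
  exact Finset.sum_congr rfl fun _ _ => by ring

theorem iidExp_sum {ι : Type*} (s : Finset ι) (f : ι → (Fin m → Fin d) → ℝ) :
    iidExp q (fun x => ∑ i ∈ s, f i x) = ∑ i ∈ s, iidExp q (f i) := by
  simp only [iidExp, Finset.mul_sum]
  exact Finset.sum_comm

theorem iidExp_succ (f : (Fin (m + 1) → Fin d) → ℝ) :
    iidExp q f = ∑ i, q i * iidExp q fun x => f (Fin.cons i x) := by
  unfold iidExp
  rw [← (Fin.consEquiv fun _ => Fin d).sum_comp, Fintype.sum_prod_type]
  refine Finset.sum_congr rfl fun i _ => ?_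
  rw [Finset.mul_sum]
  refine Finset.sum_congr rfl fun x _ => ?_
  simp [Fin.consEquiv, Fin.prod_univ_succ, mul_assoc]

theorem iidExp_append {k : ℕ} (f : (Fin (m + k) → Fin d) → ℝ) :
    iidExp q f = iidExp q fun x => iidExp q fun y => f (Fin.append x y) := by
  unfold iidExp
  rw [← (Fin.appendEquiv m k).sum_comp, Fintype.sum_prod_type]
  refine Finset.sum_congr rfl fun x _ => ?_
  rw [Finset.mul_sum]
  refine Finset.sum_congr rfl fun y _ => ?_
  simp [Fin.appendEquiv, Fin.prod_univ_add, mul_assoc]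

variable {q}

theorem iidExp_mono (hq : ∀ i, 0 ≤ q i) {f g : (Fin m → Fin d) → ℝ} (h : ∀ x, f x ≤ g x) :
    iidExp q f ≤ iidExp q g :=
  Finset.sum_le_sum fun x _ =>
    mul_le_mul_of_nonneg_left (h x) (Finset.prod_nonneg fun _ _ => hq _)

theorem iidExp_const (hq : ∑ i, q i = 1) (c : ℝ) :
    iidExp q (fun _ : Fin m → Fin d => c) = c := by
  induction m with
  | zero => simp [iidExp]
  | succ m ih => rw [iidExp_succ]; simp [ih, ← Finset.sum_mul, hq]

theorem iidExp_sum_apply (hq : ∑ i, q i = 1) (f : Fin d → ℝ) :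
    iidExp q (fun x : Fin m → Fin d => ∑ t, f (x t)) = m * ∑ i, q i * f i := by
  induction m with
  | zero => simp [iidExp]
  | succ m ih =>
    rw [iidExp_succ]
    simp only [Fin.sum_univ_succ, Fin.cons_zero, Fin.cons_succ, iidExp_add, iidExp_const hq, ih,
      mul_add, Finset.sum_add_distrib, ← Finset.sum_mul, hq]
    push_cast
    ring

/-- Expanding the square, the $m$ diagonal terms give the second moment, and the $m(m-1)$ ordered
pairs of distinct samples factor by independence. -/
theorem iidExp_sum_apply_sq (hq : ∑ i, q i = 1) (f : Fin d → ℝ) :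
    iidExp q (fun x : Fin m → Fin d => (∑ t, f (x t)) ^ 2) =
      m * ∑ i, q i * f i ^ 2 + m * (m - 1) * (∑ i, q i * f i) ^ 2 := by
  induction m with
  | zero => simp [iidExp]
  | succ m ih =>
    have hx : ∀ (i : Fin d) (x : Fin m → Fin d), (f i + ∑ t, f (x t)) ^ 2 =
        f i ^ 2 + ((2 * f i) * (∑ t, f (x t)) + (∑ t, f (x t)) ^ 2) := fun i x => by ring
    have h2 : ∀ c : ℝ, ∑ i, q i * (2 * f i * c) = 2 * c * ∑ i, q i * f i := fun c => by
      rw [Finset.mul_sum]; exact Finset.sum_congr rfl fun _ _ => by ring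
    rw [iidExp_succ]
    simp only [Fin.sum_univ_succ, Fin.cons_zero, Fin.cons_succ, hx, iidExp_add, iidExp_const_mul,
      iidExp_const hq, iidExp_sum_apply hq, ih]
    simp only [mul_add, Finset.sum_add_distrib, ← Finset.sum_mul, hq]
    simp only [← mul_add, h2]
    push_cast
    ring

end iidExp

theorem testProb_eq_iidExp {d T : ℕ} (q : Fin d → ℝ) (test : (Fin T → Fin d) → Bool) (b : Bool) :
    testProb q test b = iidExp q fun x => if test x = b then 1 else 0 := by
  simp [testProb, iidExp]

theorem testProb_nonneg {d T : ℕ} {q : Fin d → ℝ} (hq : ∀ i, 0 ≤ q i)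
    (test : (Fin T → Fin d) → Bool) (b : Bool) : 0 ≤ testProb q test b :=
  Finset.sum_nonneg fun _ _ => by
    split_ifs
    exacts [Finset.prod_nonneg fun _ _ => hq _, le_rfl]

/-- Chebyshev's inequality for the probability that a test gives the answer `b`. -/
theorem le_testProb_of_chebyshev {d T : ℕ} {q : Fin d → ℝ} (hq : q ∈ stdSimplex ℝ (Fin d))
    (test : (Fin T → Fin d) → Bool) (b : Bool) (Z : (Fin T → Fin d) → ℝ) (μ r : ℝ) (hr : 0 < r)
    (htest : ∀ x, test x ≠ b → r ≤ |Z x - μ|) :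
    1 - (iidExp q fun x => (Z x - μ) ^ 2) / r ^ 2 ≤ testProb q test b := by
  have h1 : (1 : ℝ) = iidExp q fun _ : Fin T → Fin d => (1 : ℝ) := (iidExp_const hq.2 1).symm
  rw [testProb_eq_iidExp, sub_le_iff_le_add, div_eq_inv_mul, ← iidExp_const_mul, ← iidExp_add, h1]
  refine iidExp_mono hq.1 fun x => ?_
  by_cases hx : test x = b
  · simp only [hx, if_true]
    have : 0 ≤ (r ^ 2)⁻¹ * (Z x - μ) ^ 2 := by positivity
    linarith
  · simp only [hx, if_false, zero_add]
    rw [← div_eq_inv_mul, one_le_div (by positivity), ← sq_abs (Z x - μ)]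
    exact pow_le_pow_left₀ hr.le (htest x hx) 2

/-! ### Counting collisions between two halves of the sample -/

/-- The number of collisions between the first `m` and the last `m` samples. -/
def crossCollisions {d m : ℕ} (x : Fin (m + m) → Fin d) : ℝ :=
  ∑ t : Fin m, ∑ s : Fin m, if x (Fin.castAdd m s) = x (Fin.natAdd m t) then 1 else 0

section collisions

variable {d m : ℕ} {q : Fin d → ℝ}

/-- Conditionally on the first half, the count is a sum of i.i.d. terms over the second half. This
is why collisions are counted only across the halves: the moments follow from two applications of
the one-sample formulas. -/
theorem iidExp_crossCollisions (hq : ∑ i, q i = 1) :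
    iidExp q (crossCollisions : (Fin (m + m) → Fin d) → ℝ) = m ^ 2 * ∑ i, q i ^ 2 := by
  rw [iidExp_append]
  simp only [crossCollisions, Fin.append_left, Fin.append_right]
  have h : ∀ x : Fin m → Fin d,
      iidExp q (fun y : Fin m → Fin d => ∑ t, ∑ s, if x s = y t then (1 : ℝ) else 0) =
        m * ∑ s, q (x s) := fun x => by
    rw [iidExp_sum_apply hq fun i => ∑ s, if x s = i then (1 : ℝ) else 0]
    simp only [Finset.mul_sum]
    rw [Finset.sum_comm]
    simp
  simp only [h, iidExp_const_mul, iidExp_sum_apply hq q]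
  simp only [pow_two]
  ring

theorem iidExp_crossCollisions_sq (hq : ∑ i, q i = 1) :
    iidExp q (fun x : Fin (m + m) → Fin d => crossCollisions x ^ 2) =
      m ^ 2 * ∑ i, q i ^ 2 + 2 * (m ^ 2 * (m - 1)) * ∑ i, q i ^ 3 +
        m ^ 2 * (m - 1) ^ 2 * (∑ i, q i ^ 2) ^ 2 := by
  rw [iidExp_append]
  simp only [crossCollisions, Fin.append_left, Fin.append_right]
  have h : ∀ x : Fin m → Fin d,
      iidExp q (fun y : Fin m → Fin d => (∑ t, ∑ s, if x s = y t then (1 : ℝ) else 0) ^ 2) =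
        m * (∑ i, q i * (∑ s, if x s = i then (1 : ℝ) else 0) ^ 2) +
          m * (m - 1) * (∑ s, q (x s)) ^ 2 := fun x => by
    rw [iidExp_sum_apply_sq hq fun i => ∑ s, if x s = i then (1 : ℝ) else 0]
    congr 3
    simp only [Finset.mul_sum]
    rw [Finset.sum_comm]
    simp
  simp only [h, iidExp_add, iidExp_const_mul, iidExp_sum]
  have h1 : ∀ i, iidExp q (fun x : Fin m → Fin d => (∑ s, if x s = i then (1 : ℝ) else 0) ^ 2) =
      m * q i + m * (m - 1) * q i ^ 2 := fun i => by
    rw [iidExp_sum_apply_sq hq fun j => if j = i then (1 : ℝ) else 0]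
    simp
  rw [iidExp_sum_apply_sq hq q]
  simp only [h1, mul_add, Finset.sum_add_distrib]
  have e1 : ∑ i, q i * (m * q i) = m * ∑ i, q i ^ 2 := by
    rw [Finset.mul_sum]; exact Finset.sum_congr rfl fun _ _ => by ring
  have e2 : ∑ i, q i * (m * (m - 1) * q i ^ 2) = m * (m - 1) * ∑ i, q i ^ 3 := by
    rw [Finset.mul_sum]; exact Finset.sum_congr rfl fun _ _ => by ring
  have e3 : ∑ i, q i * q i ^ 2 = ∑ i, q i ^ 3 := Finset.sum_congr rfl fun _ _ => by ring
  have e4 : ∑ i, q i * q i = ∑ i, q i ^ 2 := Finset.sum_congr rfl fun _ _ => by ring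
  rw [e1, e2, e3, e4]
  ring

theorem variance_crossCollisions (hq : ∑ i, q i = 1) :
    iidExp q (fun x : Fin (m + m) → Fin d => (crossCollisions x - m ^ 2 * ∑ i, q i ^ 2) ^ 2) =
      m ^ 2 * (∑ i, q i ^ 2 - (∑ i, q i ^ 2) ^ 2) +
        2 * (m ^ 2 * (m - 1)) * (∑ i, q i ^ 3 - (∑ i, q i ^ 2) ^ 2) := by
  set b := ∑ i, q i ^ 2 with hb
  have hx : ∀ x : Fin (m + m) → Fin d, (crossCollisions x - m ^ 2 * b) ^ 2 =
      crossCollisions x ^ 2 + (-(2 * (m ^ 2 * b)) * crossCollisions x + (m ^ 2 * b) ^ 2) :=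
    fun x => by ring
  simp only [hx]
  rw [iidExp_add, iidExp_add, iidExp_const_mul, iidExp_const hq, iidExp_crossCollisions hq,
    iidExp_crossCollisions_sq hq, ← hb]
  ring

end collisions

/-- Answer "uniform" iff the number of collisions between the two halves of the sample is close to
its expected value for the uniform distribution. -/
def collisionTest {d m : ℕ} (ε : ℝ) (x : Fin (m + m) → Fin d) : Bool :=
  -- The threshold lies halfway between the uniform mean $m^2/d$ and $m^2(1+\varepsilon^2)/d$, the
  -- least mean possible for a far distribution.
  decide (crossCollisions x < (m : ℝ) ^ 2 * ((1 + ε ^ 2 / 2) / d))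

/-! ### Power sums in terms of the $L^2$ distance to uniform -/

section deviation

variable {d : ℕ} {q : Fin d → ℝ}

theorem sum_sq_sub_uniform (hd : 0 < d) (hq : ∑ i, q i = 1) :
    ∑ i, (q i - 1 / (d : ℝ)) ^ 2 = ∑ i, q i ^ 2 - 1 / d := by
  have hd' : (d : ℝ) ≠ 0 := by positivity
  have h : ∀ i, (q i - 1 / (d : ℝ)) ^ 2 = q i ^ 2 + (-(2 / d) * q i + (1 / d) ^ 2) :=
    fun i => by ring
  simp only [h, Finset.sum_add_distrib, ← Finset.mul_sum, hq]
  simp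
  field_simp
  ring

/-- The left side is the variance of $q(X)$ for $X \sim q$. Expanding about $1/d$ leaves $D^2/d -
D^4$ plus the sum of cubed deviations, and each deviation is at most $D$. -/
theorem sum_cube_sub_sq_le (hd : 0 < d) (hq : ∑ i, q i = 1) {D : ℝ} (hD : 0 ≤ D)
    (hDq : ∑ i, (q i - 1 / (d : ℝ)) ^ 2 = D ^ 2) :
    ∑ i, q i ^ 3 - (∑ i, q i ^ 2) ^ 2 ≤ D ^ 2 / d + D ^ 3 := by
  have hd' : (d : ℝ) ≠ 0 := by positivity
  have hb : ∑ i, q i ^ 2 = D ^ 2 + 1 / d := by rw [← hDq, sum_sq_sub_uniform hd hq]; ring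
  have hcube : ∑ i, (q i - 1 / (d : ℝ)) ^ 3 ≤ D ^ 3 := by
    calc ∑ i, (q i - 1 / (d : ℝ)) ^ 3 ≤ ∑ i, D * (q i - 1 / (d : ℝ)) ^ 2 := by
          refine Finset.sum_le_sum fun i hi => ?_
          rw [pow_succ' (q i - 1 / (d : ℝ)) 2]
          refine mul_le_mul_of_nonneg_right (abs_le_of_sq_le_sq' ?_ hD).2 (sq_nonneg _)
          rw [← hDq]
          exact Finset.single_le_sum (f := fun i => (q i - 1 / (d : ℝ)) ^ 2)
            (fun i _ => sq_nonneg _) hi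
      _ = D ^ 3 := by rw [← Finset.mul_sum, hDq]; ring
  have hexp : ∑ i, (q i - 1 / (d : ℝ)) ^ 3 =
      ∑ i, q i ^ 3 - 3 / d * ∑ i, q i ^ 2 + 2 / d ^ 2 := by
    have h : ∀ i, (q i - 1 / (d : ℝ)) ^ 3 =
        q i ^ 3 + (-(3 / d) * q i ^ 2 + (3 / d ^ 2 * q i + -(1 / d) ^ 3)) := fun i => by ring
    simp only [h, Finset.sum_add_distrib, ← Finset.mul_sum, hq]
    simp
    field_simp
    ring
  have h3 : ∑ i, q i ^ 3 = ∑ i, (q i - 1 / (d : ℝ)) ^ 3 + 3 / d * (D ^ 2 + 1 / d) - 2 / d ^ 2 := by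
    rw [hexp, hb]; ring
  rw [h3, hb]
  have h4 : 3 / (d : ℝ) * (D ^ 2 + 1 / d) - 2 / d ^ 2 - (D ^ 2 + 1 / d) ^ 2 =
      D ^ 2 / d - (D ^ 2) ^ 2 := by
    field_simp
    ring
  nlinarith [sq_nonneg (D ^ 2)]

end deviation

/-- Chebyshev's requirement in scale-free variables: $u = m/\sqrt d$, $s = D\sqrt d$, $w = \sqrt d$.
The left side bounds the variance, and $u^2s^2/2 = m^2D^2/2$ is the gap between mean and threshold.
-/
theorem collision_variance_bound {u s w ε : ℝ} (hε : 0 < ε) (hε1 : ε < 1) (hs : ε ≤ s)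
    (hw : 1 ≤ w) (hu : 200 / ε ^ 2 ≤ u) :
    u ^ 2 * (1 + s ^ 2) + 2 * u ^ 3 * (s ^ 2 / w + s ^ 3) ≤ (u ^ 2 * s ^ 2 / 2) ^ 2 / 10 := by
  have hs0 : 0 < s := hε.trans_le hs
  have hu' : 200 ≤ u * ε ^ 2 := (div_le_iff₀ (by positivity)).1 hu
  have hu0 : 0 < u := by
    have : 0 < 200 / ε ^ 2 := by positivity
    linarith
  have h1 : 200 ≤ u * s ^ 2 :=
    hu'.trans (mul_le_mul_of_nonneg_left (pow_le_pow_left₀ hε.le hs 2) hu0.le)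
  have h2 : 200 ≤ u * s := by
    refine hu'.trans (mul_le_mul_of_nonneg_left ?_ hu0.le)
    -- Here $\varepsilon < 1$ enters, through $\varepsilon^2 \le \varepsilon \le s$.
    nlinarith
  have h3 : s ^ 2 / w ≤ s ^ 2 := div_le_self (by positivity) hw
  have key : 1 + s ^ 2 + 2 * u * (s ^ 2 + s ^ 3) ≤ u ^ 2 * s ^ 4 / 40 := by
    have k1 : 200 * (u * s ^ 2) ≤ (u * s ^ 2) * (u * s ^ 2) :=
      mul_le_mul_of_nonneg_right h1 (by positivity)
    have k2 : 200 * (u * s ^ 3) ≤ (u * s) * (u * s ^ 3) :=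
      mul_le_mul_of_nonneg_right h2 (by positivity)
    have k3 : 200 ^ 2 * s ^ 2 ≤ (u * s) ^ 2 * s ^ 2 :=
      mul_le_mul_of_nonneg_right (pow_le_pow_left₀ (by norm_num) h2 2) (by positivity)
    have e2 : (u * s) * (u * s ^ 3) = (u * s ^ 2) * (u * s ^ 2) := by ring
    have e3 : (u * s) ^ 2 * s ^ 2 = (u * s ^ 2) * (u * s ^ 2) := by ring
    have e4 : u ^ 2 * s ^ 4 = (u * s ^ 2) * (u * s ^ 2) := by ring
    rw [e2] at k2
    rw [e3] at k3
    rw [e4]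
    nlinarith
  calc u ^ 2 * (1 + s ^ 2) + 2 * u ^ 3 * (s ^ 2 / w + s ^ 3)
      ≤ u ^ 2 * (1 + s ^ 2) + 2 * u ^ 3 * (s ^ 2 + s ^ 3) := by gcongr
    _ = u ^ 2 * (1 + s ^ 2 + 2 * u * (s ^ 2 + s ^ 3)) := by ring
    _ ≤ u ^ 2 * (u ^ 2 * s ^ 4 / 40) := by gcongr
    _ = _ := by ring

theorem collisionTest_uniform {d m : ℕ} (hd : 0 < d) {ε : ℝ} (hε : 0 < ε)
    (hm : 200 / ε ^ 2 * √d ≤ m) :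
    9 / 10 ≤ testProb (fun _ => 1 / (d : ℝ)) (collisionTest (d := d) (m := m) ε) true := by
  have hd' : (0 : ℝ) < d := by exact_mod_cast hd
  have hw : 0 < √(d : ℝ) := Real.sqrt_pos.2 hd'
  have hm0 : (0 : ℝ) < m := lt_of_lt_of_le (by positivity) hm
  have hq : (fun _ : Fin d => 1 / (d : ℝ)) ∈ stdSimplex ℝ (Fin d) :=
    ⟨fun _ => by positivity, by simp [hd'.ne']⟩
  have hb : ∑ _i : Fin d, (1 / (d : ℝ)) ^ 2 = 1 / (d : ℝ) := by
    simp
    field_simp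
  have hQ : ∑ _i : Fin d, (1 / (d : ℝ)) ^ 3 = (1 / (d : ℝ)) ^ 2 := by
    simp
    field_simp
  have hmean : (m : ℝ) ^ 2 * ∑ _i : Fin d, (1 / (d : ℝ)) ^ 2 = m ^ 2 / d := by rw [hb]; ring
  have hvar := variance_crossCollisions (m := m) hq.2
  -- For uniform $q$ the cubic part of the variance vanishes, since $\sum q_i^3 = (\sum q_i^2)^2$.
  rw [hmean, hb, hQ, sub_self, mul_zero, add_zero] at hvar
  have hch := le_testProb_of_chebyshev hq (collisionTest (d := d) (m := m) ε) true crossCollisions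
    ((m : ℝ) ^ 2 / d) (m ^ 2 * (ε ^ 2 / 2) / d) (by positivity) fun x hx => by
      refine le_trans ?_ (le_abs_self _)
      have : (m : ℝ) ^ 2 * ((1 + ε ^ 2 / 2) / d) ≤ crossCollisions x := by
        simpa [collisionTest] using hx
      have e : (m : ℝ) ^ 2 * ((1 + ε ^ 2 / 2) / d) = m ^ 2 / d + m ^ 2 * (ε ^ 2 / 2) / d := by ring
      linarith
  refine le_trans ?_ hch
  rw [hvar]
  have hle : (m : ℝ) ^ 2 * (1 / d - (1 / d) ^ 2) ≤ (m ^ 2 * (ε ^ 2 / 2) / d) ^ 2 / 10 := by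
    have h1 : (200 * √d) ≤ m * ε ^ 2 := by
      have := mul_le_mul_of_nonneg_right hm (sq_nonneg ε)
      field_simp at this
      linarith
    have h2 : 200 ^ 2 * (d : ℝ) ≤ m ^ 2 * ε ^ 4 := by
      calc 200 ^ 2 * (d : ℝ) = (200 * √d) ^ 2 := by rw [mul_pow, Real.sq_sqrt hd'.le]
        _ ≤ (m * ε ^ 2) ^ 2 := pow_le_pow_left₀ (by positivity) h1 2
        _ = _ := by ring
    calc (m : ℝ) ^ 2 * (1 / (d : ℝ) - (1 / d) ^ 2) ≤ (m : ℝ) ^ 2 * (1 / d) := by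
          gcongr
          linarith [sq_nonneg (1 / (d : ℝ))]
      _ = (m : ℝ) ^ 2 / (d : ℝ) ^ 2 * d := by field_simp
      _ ≤ (m : ℝ) ^ 2 / (d : ℝ) ^ 2 * (m ^ 2 * ε ^ 4 / 40) := by gcongr; linarith
      _ = _ := by ring
  have := (div_le_iff₀ (by positivity : 0 < ((m : ℝ) ^ 2 * (ε ^ 2 / 2) / d) ^ 2)).2
    (hle.trans_eq (by ring : _ = 1 / 10 * ((m : ℝ) ^ 2 * (ε ^ 2 / 2) / d) ^ 2))
  linarith

theorem collisionTest_far {d m : ℕ} (hd : 0 < d) {ε : ℝ} (hε : 0 < ε) (hε1 : ε < 1)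
    (hm : 200 / ε ^ 2 * √d ≤ m) {q : Fin d → ℝ} (hq : q ∈ stdSimplex ℝ (Fin d))
    (hfar : ε / √(d : ℝ) ≤ √(∑ i, (q i - 1 / (d : ℝ)) ^ 2)) :
    9 / 10 ≤ testProb q (collisionTest (m := m) ε) false := by
  have hd' : (0 : ℝ) < d := by exact_mod_cast hd
  set w := √(d : ℝ) with hwdef
  have hw : 0 < w := Real.sqrt_pos.2 hd'
  have hw1 : 1 ≤ w := Real.one_le_sqrt.2 (by exact_mod_cast hd)
  have hdw : (d : ℝ) = w ^ 2 := (Real.sq_sqrt hd'.le).symm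
  have hm0 : (0 : ℝ) < m := lt_of_lt_of_le (by positivity) hm
  set D := √(∑ i, (q i - 1 / (d : ℝ)) ^ 2) with hDdef
  have hD0 : 0 ≤ D := Real.sqrt_nonneg _
  have hDsq : ∑ i, (q i - 1 / (d : ℝ)) ^ 2 = D ^ 2 :=
    (Real.sq_sqrt (Finset.sum_nonneg fun _ _ => sq_nonneg _)).symm
  have hb : ∑ i, q i ^ 2 = D ^ 2 + 1 / d := by
    rw [← hDsq, sum_sq_sub_uniform hd hq.2]; ring
  have hQ := sum_cube_sub_sq_le hd hq.2 hD0 hDsq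
  have hs : ε ≤ D * w := (div_le_iff₀ hw).1 hfar
  have hu : 200 / ε ^ 2 ≤ m / w := (le_div_iff₀ hw).2 hm
  have hmain := collision_variance_bound hε hε1 hs hw1 hu
  have hs0 : 0 < D * w := hε.trans_le hs
  have hvar := variance_crossCollisions (m := m) hq.2
  have hm1 : (1 : ℝ) ≤ m := by
    have : 0 < m := by exact_mod_cast hm0
    exact_mod_cast this
  have hr : 0 < (m / w) ^ 2 * (D * w) ^ 2 / 2 := by positivity
  have hvle : iidExp q (fun x : Fin (m + m) → Fin d =>
      (crossCollisions x - m ^ 2 * ∑ i, q i ^ 2) ^ 2) ≤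
        1 / 10 * ((m / w) ^ 2 * (D * w) ^ 2 / 2) ^ 2 := by
    rw [hvar]
    calc (m : ℝ) ^ 2 * (∑ i, q i ^ 2 - (∑ i, q i ^ 2) ^ 2) +
          2 * (m ^ 2 * (m - 1)) * (∑ i, q i ^ 3 - (∑ i, q i ^ 2) ^ 2)
        ≤ m ^ 2 * (D ^ 2 + 1 / d) + 2 * (m ^ 2 * m) * (D ^ 2 / d + D ^ 3) := by
          refine add_le_add (mul_le_mul_of_nonneg_left ?_ (by positivity)) ?_
          · rw [← hb]; linarith [sq_nonneg (∑ i, q i ^ 2)]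
          · calc 2 * ((m : ℝ) ^ 2 * (m - 1)) * (∑ i, q i ^ 3 - (∑ i, q i ^ 2) ^ 2)
                ≤ 2 * ((m : ℝ) ^ 2 * (m - 1)) * (D ^ 2 / d + D ^ 3) :=
                  mul_le_mul_of_nonneg_left hQ
                    (mul_nonneg two_pos.le (mul_nonneg (sq_nonneg _) (by linarith)))
              _ ≤ 2 * (m ^ 2 * m) * (D ^ 2 / d + D ^ 3) := by gcongr; linarith
      _ = (m / w) ^ 2 * (1 + (D * w) ^ 2) +
          2 * (m / w) ^ 3 * ((D * w) ^ 2 / w + (D * w) ^ 3) := by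
          rw [hdw]
          field_simp
          ring
      _ ≤ _ := hmain.trans_eq (by ring)
  -- A wrong answer puts the count below the threshold, which lies at least $m^2D^2/2$ below the
  -- mean because $\varepsilon^2 \le dD^2$.
  have hch := le_testProb_of_chebyshev hq (collisionTest (m := m) ε) false crossCollisions
    ((m : ℝ) ^ 2 * ∑ i, q i ^ 2) _ hr fun x hx => by
      rw [abs_sub_comm]
      refine le_trans ?_ (le_abs_self _)
      have hlt : crossCollisions x < (m : ℝ) ^ 2 * ((1 + ε ^ 2 / 2) / d) := by
        simpa [collisionTest] using hx
      have hε2 : ε ^ 2 ≤ (D * w) ^ 2 := pow_le_pow_left₀ hε.le hs 2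
      have h1 : (m : ℝ) ^ 2 * ((1 + ε ^ 2 / 2) / d) ≤
          m ^ 2 * ((1 + (D * w) ^ 2 / 2) / d) := by gcongr
      have h2 : (m : ℝ) ^ 2 * ((1 + (D * w) ^ 2 / 2) / d) =
          m ^ 2 * (D ^ 2 + 1 / d) - (m / w) ^ 2 * (D * w) ^ 2 / 2 := by
        rw [hdw]
        field_simp
        ring
      rw [hb]
      linarith
  have := (div_le_iff₀ (pow_pos hr 2)).2 hvle
  linarith

theorem isL2UniformityTester_collisionTest {d m : ℕ} (hd : 0 < d) {ε : ℝ} (hε : 0 < ε)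
    (hε1 : ε < 1) (hm : 200 / ε ^ 2 * √d ≤ m) :
    IsL2UniformityTester ε (collisionTest (d := d) (m := m) ε) :=
  ⟨collisionTest_uniform hd hε hm, fun _ hq hfar => collisionTest_far hd hε hε1 hm hq hfar⟩

/-! ### A finite family of two-dimensional rotations -/

/-- A curve of linear functionals on `ℝ³`: a nonzero vector is annihilated by at most four of
them. -/
def curveFunctional (t : ℝ) : (Fin 3 → ℝ) →ₗ[ℝ] ℝ :=
  (1 - t ^ 2 - t ^ 4) • LinearMap.proj 0 + t • LinearMap.proj 1 + t ^ 2 • LinearMap.proj 2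

theorem curveFunctional_apply (t : ℝ) (r : Fin 3 → ℝ) :
    curveFunctional t r = (1 - t ^ 2 - t ^ 4) * r 0 + t * r 1 + t ^ 2 * r 2 := by
  simp [curveFunctional]

/-- For fixed $r$ the functional is a polynomial in $t$ of degree at most 4, whose coefficients in
degrees 0, 1, 2 already determine $r$. -/
theorem eq_zero_of_curveFunctional_eq_zero {ι : Type*} [Fintype ι] (hι : 5 ≤ Fintype.card ι)
    {t : ι → ℝ} (ht : Function.Injective t) {r : Fin 3 → ℝ}
    (h : ∀ j, curveFunctional (t j) r = 0) : r = 0 := by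
  open Polynomial in
  let P : ℝ[X] := C (-r 0) * X ^ 4 + C (r 2 - r 0) * X ^ 2 + C (r 1) * X + C (r 0)
  have hdeg : P.natDegree < Fintype.card ι :=
    lt_of_le_of_lt (by unfold P; compute_degree) hι
  have hP : P = 0 := by
    refine Polynomial.eq_zero_of_natDegree_lt_card_of_eval_eq_zero P ht (fun j => ?_) hdeg
    rw [← h j, curveFunctional_apply]
    simp only [P, Polynomial.eval_add, Polynomial.eval_mul, Polynomial.eval_C,
      Polynomial.eval_pow, Polynomial.eval_X]
    ring
  have h0 := congrArg (fun Q => Q.coeff 0) hP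
  have h1 := congrArg (fun Q => Q.coeff 1) hP
  have h2 := congrArg (fun Q => Q.coeff 2) hP
  simp only [P, Polynomial.coeff_add, Polynomial.coeff_C_mul, Polynomial.coeff_X_pow,
    Polynomial.coeff_X, Polynomial.coeff_C, Polynomial.coeff_zero] at h0 h1 h2
  norm_num at h0 h1 h2
  ext i
  fin_cases i
  · simpa using h0
  · simpa using h1
  · simp; linarith

/-- Quantitative form of the root count: an injective linear map from a finite-dimensional space is
bounded below, and in the sup norm some coordinate attains the bound. -/
theorem exists_curveFunctional_bound {ι : Type*} [Fintype ι] (hι : 5 ≤ Fintype.card ι)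
    {t : ι → ℝ} (ht : Function.Injective t) :
    ∃ c : ℝ, 0 < c ∧ ∀ r : Fin 3 → ℝ, ∃ j, c * ‖r‖ ≤ |curveFunctional (t j) r| := by
  have : Nonempty ι := Fintype.card_pos_iff.1 (by omega)
  let L : (Fin 3 → ℝ) →ₗ[ℝ] (ι → ℝ) := LinearMap.pi fun j => curveFunctional (t j)
  have hL : LinearMap.ker L = ⊥ := by
    rw [LinearMap.ker_eq_bot']
    exact fun r hr => eq_zero_of_curveFunctional_eq_zero hι ht fun j => congrFun hr j
  obtain ⟨K, hK, hLK⟩ := L.exists_antilipschitzWith hL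
  refine ⟨(K : ℝ)⁻¹, by positivity, fun r => ?_⟩
  have h := hLK.le_mul_dist r 0
  rw [map_zero, dist_zero_right, dist_zero_right] at h
  obtain ⟨j, hj⟩ := Finite.exists_max fun j => |curveFunctional (t j) r|
  refine ⟨j, (inv_mul_le_iff₀ (by positivity)).2 (h.trans ?_)⟩
  gcongr
  exact (pi_norm_le_iff_of_nonneg (abs_nonneg _)).2 fun i => hj i

theorem exists_card_curveFunctional_lt_le (N : ℕ) :
    ∃ c : ℝ, 0 < c ∧ ∀ r : Fin 3 → ℝ,
      (Finset.univ.filter fun j : Fin N => |curveFunctional (j : ℕ) r| < c * ‖r‖).card ≤ 4 := by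
  have h : ∀ S : Finset (Fin N), ∃ c : ℝ, 0 < c ∧ (5 ≤ S.card → ∀ r : Fin 3 → ℝ,
      ∃ j ∈ S, c * ‖r‖ ≤ |curveFunctional (j : ℕ) r|) := fun S => by
    by_cases hS : 5 ≤ S.card
    · obtain ⟨c, hc, h⟩ := exists_curveFunctional_bound (ι := S) (by simpa using hS)
        (t := fun j => ((j : Fin N) : ℕ)) fun i j hij => 
          Subtype.ext (Fin.ext (Nat.cast_injective (R := ℝ) hij))
      exact ⟨c, hc, fun _ r => let ⟨j, hj⟩ := h r; ⟨j, j.2, hj⟩⟩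
    · exact ⟨1, one_pos, fun h => absurd h hS⟩
  choose c hc hcS using h
  -- One constant serves all index sets, as there are finitely many. The set of small values would
  -- violate its own bound if it had five elements.
  obtain ⟨S₀, hS₀⟩ := Finite.exists_min c
  refine ⟨c S₀, hc S₀, fun r => ?_⟩
  by_contra! hcard
  obtain ⟨j, hj, hjr⟩ := hcS _ hcard r
  have h1 := (Finset.mem_filter.1 hj).2
  have h2 := mul_le_mul_of_nonneg_right (hS₀ (Finset.univ.filter fun j : Fin N =>
    |curveFunctional (j : ℕ) r| < c S₀ * ‖r‖)) (norm_nonneg r)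
  linarith

/-- The rotation with columns proportional to `(1, z)` and `(-z̄, 1)`. -/
def rotation (z : ℂ) : Matrix (Fin 2) (Fin 2) ℂ :=
  ((√(1 + Complex.normSq z))⁻¹ : ℂ) • !![1, -star z; z, 1]

theorem sqrt_one_add_normSq_inv_sq (z : ℂ) :
    ((√(1 + Complex.normSq z))⁻¹ : ℝ) ^ 2 = (1 + Complex.normSq z)⁻¹ := by
  rw [inv_pow, Real.sq_sqrt (by linarith [Complex.normSq_nonneg z])]

theorem rotation_mem_unitaryGroup (z : ℂ) : rotation z ∈ unitaryGroup (Fin 2) ℂ := by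
  have hpos : 0 < 1 + Complex.normSq z := by linarith [Complex.normSq_nonneg z]
  have hs : ((√(1 + Complex.normSq z))⁻¹ : ℂ) * ((√(1 + Complex.normSq z))⁻¹ : ℂ) *
      (1 + z * star z) = 1 := by
    have h := sqrt_one_add_normSq_inv_sq z
    have h1 : ((√(1 + Complex.normSq z))⁻¹ : ℂ) * ((√(1 + Complex.normSq z))⁻¹ : ℂ) =
        ((1 + Complex.normSq z)⁻¹ : ℝ) := by
      rw [← h]; push_cast; ring
    have h2 : 1 + z * star z = ((1 + Complex.normSq z : ℝ) : ℂ) := by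
      push_cast; rw [← Complex.mul_conj]; rfl
    rw [h1, h2, ← Complex.ofReal_mul, inv_mul_cancel₀ hpos.ne', Complex.ofReal_one]
  have hstar : star !![1, -star z; z, 1] = !![1, star z; -z, 1] := by
    ext i j
    fin_cases i <;> fin_cases j <;> simp [star_apply]
  have hmul : !![1, -star z; z, 1] * !![1, star z; -z, 1] = (1 + z * star z) • 1 := by
    rw [Matrix.mul_fin_two, Matrix.one_fin_two]
    ext i j
    fin_cases i <;> fin_cases j <;> simp <;> ring
  have hreal : star ((√(1 + Complex.normSq z))⁻¹ : ℂ) = ((√(1 + Complex.normSq z))⁻¹ : ℂ) := by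
    rw [← Complex.ofReal_inv]
    exact Complex.conj_ofReal _
  rw [mem_unitaryGroup_iff, rotation, star_smul, hstar, hreal, smul_mul_smul_comm, hmul, smul_smul,
    hs, one_smul]

theorem normSq_vecMul_rotation_zero (z : ℂ) (v : Fin 2 → ℂ) :
    Complex.normSq ((v ᵥ* rotation z) 0) =
      (1 + Complex.normSq z)⁻¹ * Complex.normSq (v 0 + v 1 * z) := by
  have h : (v ᵥ* rotation z) 0 = ((√(1 + Complex.normSq z))⁻¹ : ℝ) * (v 0 + v 1 * z) := by
    simp [rotation, vecMul, dotProduct, Fin.sum_univ_two]; ring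
  rw [h, Complex.normSq_mul, Complex.normSq_ofReal, ← pow_two, sqrt_one_add_normSq_inv_sq]

theorem normSq_vecMul_rotation_one (z : ℂ) (v : Fin 2 → ℂ) :
    Complex.normSq ((v ᵥ* rotation z) 1) =
      (1 + Complex.normSq z)⁻¹ * Complex.normSq (v 1 - v 0 * star z) := by
  have h : (v ᵥ* rotation z) 1 = ((√(1 + Complex.normSq z))⁻¹ : ℝ) * (v 1 - v 0 * star z) := by
    simp [rotation, vecMul, dotProduct, Fin.sum_univ_two]; ring
  rw [h, Complex.normSq_mul, Complex.normSq_ofReal, ← pow_two, sqrt_one_add_normSq_inv_sq]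

theorem normSq_vecMul_rotation_add (z : ℂ) (v : Fin 2 → ℂ) :
    Complex.normSq ((v ᵥ* rotation z) 0) + Complex.normSq ((v ᵥ* rotation z) 1) =
      Complex.normSq (v 0) + Complex.normSq (v 1) := by
  have hpos : 0 < 1 + Complex.normSq z := by linarith [Complex.normSq_nonneg z]
  rw [normSq_vecMul_rotation_zero, normSq_vecMul_rotation_one, ← mul_add,
    inv_mul_eq_iff_eq_mul₀ hpos.ne']
  simp [Complex.normSq_apply]
  ring

/-- The Stokes parameters of a vector in `ℂ²`, the last two of them doubled. -/
def stokes (v : Fin 2 → ℂ) : Fin 3 → ℝ :=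
  ![Complex.normSq (v 0) - Complex.normSq (v 1), 4 * (v 0 * star (v 1)).re,
    4 * (v 0 * star (v 1)).im]

/-- With $p$ the squared norm of `v`, the Stokes identity reads $r_0^2 + r_1^2/4 + r_2^2/4 = p^2$.
If all $|r_i| < p/2$, the left side would be below $\frac38 p^2$. -/
theorem le_norm_stokes (v : Fin 2 → ℂ) :
    (Complex.normSq (v 0) + Complex.normSq (v 1)) / 2 ≤ ‖stokes v‖ := by
  by_contra! h
  have h' : ∀ i, |stokes v i| < (Complex.normSq (v 0) + Complex.normSq (v 1)) / 2 :=
    fun i => (norm_le_pi_norm (stokes v) i).trans_lt h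
  have hp := (abs_nonneg _).trans_lt (h' 0)
  have hsq : ∀ i, stokes v i ^ 2 < ((Complex.normSq (v 0) + Complex.normSq (v 1)) / 2) ^ 2 :=
    fun i => by
      rw [← sq_abs]
      exact pow_lt_pow_left₀ (h' i) (abs_nonneg _) two_ne_zero
  have key : stokes v 0 ^ 2 + stokes v 1 ^ 2 / 4 + stokes v 2 ^ 2 / 4 =
      (Complex.normSq (v 0) + Complex.normSq (v 1)) ^ 2 := by
    simp [stokes, Complex.normSq_apply]
    ring
  have h0 := hsq 0
  have h1 := hsq 1
  have h2 := hsq 2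
  nlinarith

/-- The `j`-th member of a family of rotations; no vector is nearly balanced in more than four of
the corresponding bases. -/
def curveRotation (j : ℕ) : Matrix (Fin 2) (Fin 2) ℂ := rotation ⟨j, (j : ℝ) ^ 2⟩

/-- For $z = t + it^2$ one has $|z|^2 = t^2 + t^4$, and the cross terms give $4\,\mathrm{Re}(v_0\bar
v_1\bar z)$. This explains both the shape of `curveFunctional` and the doubling in `stokes`. -/
theorem normSq_vecMul_curveRotation_sub (j : ℕ) (v : Fin 2 → ℂ) :
    Complex.normSq ((v ᵥ* curveRotation j) 0) - Complex.normSq ((v ᵥ* curveRotation j) 1) =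
      (1 + (j : ℝ) ^ 2 + (j : ℝ) ^ 4)⁻¹ * curveFunctional j (stokes v) := by
  have hz : 1 + Complex.normSq ⟨(j : ℝ), (j : ℝ) ^ 2⟩ = 1 + (j : ℝ) ^ 2 + (j : ℝ) ^ 4 := by
    rw [Complex.normSq_mk]; ring
  rw [curveRotation, normSq_vecMul_rotation_zero, normSq_vecMul_rotation_one, hz, ← mul_sub,
    curveFunctional_apply]
  congr 1
  simp [stokes, Complex.normSq_apply]
  ring

theorem exists_card_curveRotation_balanced_le (N : ℕ) :
    ∃ δ : ℝ, 0 < δ ∧ δ ≤ 1 ∧ ∀ v : Fin 2 → ℂ,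
      (Finset.univ.filter fun j : Fin N =>
        |Complex.normSq ((v ᵥ* curveRotation j) 0) - Complex.normSq ((v ᵥ* curveRotation j) 1)| <
          δ * (Complex.normSq (v 0) + Complex.normSq (v 1))).card ≤ 4 := by
  obtain ⟨c, hc, h⟩ := exists_card_curveFunctional_lt_le N
  set B : ℝ := 1 + (N : ℝ) ^ 2 + (N : ℝ) ^ 4 with hB
  have hB0 : 0 < B := by positivity
  -- `B` bounds the normalising factors $1 + j^2 + j^4$, the 2 comes from `le_norm_stokes`, and the
  -- cap at 1 later ensures $\delta/2 < 1$.
  refine ⟨min 1 (c / (2 * B)), by positivity, min_le_left _ _, fun v => ?_⟩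
  refine (Finset.card_le_card fun j hj => ?_).trans (h (stokes v))
  rw [Finset.mem_filter] at hj ⊢
  refine ⟨hj.1, ?_⟩
  have hj2 := hj.2
  have hp : 0 ≤ Complex.normSq (v 0) + Complex.normSq (v 1) :=
    add_nonneg (Complex.normSq_nonneg _) (Complex.normSq_nonneg _)
  have hjpos : 0 < 1 + ((j : ℕ) : ℝ) ^ 2 + ((j : ℕ) : ℝ) ^ 4 := by positivity
  have hjN : ((j : ℕ) : ℝ) ≤ N := by exact_mod_cast j.2.le
  have hjB : 1 + ((j : ℕ) : ℝ) ^ 2 + ((j : ℕ) : ℝ) ^ 4 ≤ B := by rw [hB]; gcongr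
  rw [normSq_vecMul_curveRotation_sub, abs_mul, abs_of_pos (inv_pos.2 hjpos),
    inv_mul_lt_iff₀ hjpos] at hj2
  calc |curveFunctional (j : ℕ) (stokes v)|
      < (1 + ((j : ℕ) : ℝ) ^ 2 + ((j : ℕ) : ℝ) ^ 4) *
          (min 1 (c / (2 * B)) * (Complex.normSq (v 0) + Complex.normSq (v 1))) := hj2
    _ ≤ B * (c / (2 * B) * (Complex.normSq (v 0) + Complex.normSq (v 1))) := by
        gcongr
        exact min_le_right _ _
    _ = c * ((Complex.normSq (v 0) + Complex.normSq (v 1)) / 2) := by field_simp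
    _ ≤ c * ‖stokes v‖ := by gcongr; exact le_norm_stokes v

/-! ### Nearly balanced pairs of outcomes -/

/-- The total mass of the pairs `(i, 0), (i, 1)` to which `q` assigns nearly equal masses. -/
def balancedMass {ι : Type*} [Fintype ι] (δ : ℝ) (q : ι × Fin 2 → ℝ) : ℝ :=
  ∑ i, if |q (i, 0) - q (i, 1)| < δ * (q (i, 0) + q (i, 1)) then q (i, 0) + q (i, 1) else 0

theorem balancedMass_nonneg {ι : Type*} [Fintype ι] (δ : ℝ) {q : ι × Fin 2 → ℝ}
    (hq : ∀ x, 0 ≤ q x) : 0 ≤ balancedMass δ q :=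
  Finset.sum_nonneg fun i _ => by
    split_ifs
    exacts [add_nonneg (hq _) (hq _), le_rfl]

/-- A distribution most of whose pairs are unbalanced is far from uniform. -/
theorem sum_sq_sub_ge_of_balancedMass_lt {ι : Type*} [Fintype ι] [Nonempty ι] {δ : ℝ} (hδ : 0 < δ)
    {q : ι × Fin 2 → ℝ} (hq : ∀ x, 0 ≤ q x) (hsum : ∑ x, q x = 1) (hb : balancedMass δ q < 1 / 2) :
    δ ^ 2 / (8 * Fintype.card ι) ≤
      ∑ x, (q x - 1 / (2 * Fintype.card ι : ℝ)) ^ 2 := by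
  set h : ℝ := ((Fintype.card ι : ℕ) : ℝ) with hh
  have hpos : 0 < h := by rw [hh]; exact_mod_cast Fintype.card_pos
  set p : ι → ℝ := fun i => q (i, 0) + q (i, 1) with hp
  set g : ι → ℝ := fun i => if |q (i, 0) - q (i, 1)| < δ * p i then 0 else p i with hg
  have hp1 : ∑ i, p i = 1 := by
    rw [← hsum, Fintype.sum_prod_type]
    simp [hp, Fin.sum_univ_two]
  have hgsum : 1 / 2 ≤ ∑ i, g i := by
    have : balancedMass δ q + ∑ i, g i = 1 := by
      rw [← hp1, balancedMass, ← Finset.sum_add_distrib]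
      refine Finset.sum_congr rfl fun i _ => ?_
      simp only [hg, hp]
      split_ifs <;> simp
    linarith
  have hgsq : 1 / 4 ≤ h * ∑ i, g i ^ 2 := by
    have := sq_sum_le_card_mul_sum_sq (s := Finset.univ) (f := g)
    rw [Finset.card_univ] at this
    nlinarith
  have hterm : ∀ i, (p i - 1 / h) ^ 2 / 2 + δ ^ 2 * g i ^ 2 / 2 ≤
      (q (i, 0) - 1 / (2 * h)) ^ 2 + (q (i, 1) - 1 / (2 * h)) ^ 2 := fun i => by
    have hdiff : δ ^ 2 * g i ^ 2 ≤ (q (i, 0) - q (i, 1)) ^ 2 := by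
      simp only [hg]
      split_ifs with hi
      · simp [sq_nonneg]
      · rw [← mul_pow]
        rw [← sq_abs (q (i, 0) - q (i, 1))]
        exact pow_le_pow_left₀ (mul_nonneg hδ.le (add_nonneg (hq _) (hq _))) (not_lt.1 hi) 2
    have e : (q (i, 0) - 1 / (2 * h)) ^ 2 + (q (i, 1) - 1 / (2 * h)) ^ 2 =
        (p i - 1 / h) ^ 2 / 2 + (q (i, 0) - q (i, 1)) ^ 2 / 2 := by
      simp only [hp]
      field_simp
      ring
    rw [e]
    linarith
  rw [Fintype.sum_prod_type]
  simp only [Fin.sum_univ_two]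
  refine le_trans ?_ (Finset.sum_le_sum fun i _ => hterm i)
  rw [Finset.sum_add_distrib, ← Finset.sum_div, ← Finset.sum_div, ← Finset.mul_sum]
  have h1 : 0 ≤ ∑ i, (p i - 1 / h) ^ 2 := Finset.sum_nonneg fun _ _ => sq_nonneg _
  have h2 : δ ^ 2 / (8 * h) ≤ δ ^ 2 * (∑ i, g i ^ 2) / 2 := by
    have : 1 / 4 / h ≤ ∑ i, g i ^ 2 := (div_le_iff₀' hpos).2 hgsq
    calc δ ^ 2 / (8 * h) = δ ^ 2 * (1 / 4 / h) / 2 := by ring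
      _ ≤ _ := by gcongr
  linarith

/-! ### Rotating all pairs at once -/

section pairRotation

open scoped Kronecker

variable {d : ℕ} {ι : Type*} [Fintype ι] [DecidableEq ι] (e : Fin d ≃ ι × Fin 2)

/-- The block diagonal unitary that applies `curveRotation j` to every pair of coordinates. -/
def pairRotation (j : ℕ) : unitaryGroup (Fin d) ℂ :=
  ⟨((1 : Matrix ι ι ℂ) ⊗ₖ curveRotation j).submatrix e e, by
    have h : (1 : Matrix ι ι ℂ) ⊗ₖ curveRotation j ∈ unitary (Matrix (ι × Fin 2) (ι × Fin 2) ℂ) :=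
      kronecker_mem_unitary (one_mem _) (rotation_mem_unitaryGroup _)
    rw [mem_unitaryGroup_iff, star_eq_conjTranspose, conjTranspose_submatrix,
      submatrix_mul_equiv, ← star_eq_conjTranspose, h.2, submatrix_one_equiv]⟩

theorem vecMul_pairRotation (j : ℕ) (w : Fin d → ℂ) (i : ι) (k : Fin 2) :
    (w ᵥ* (pairRotation e j : Matrix (Fin d) (Fin d) ℂ)) (e.symm (i, k)) =
      ((fun l => w (e.symm (i, l))) ᵥ* curveRotation j) k := by
  simp only [vecMul, dotProduct, pairRotation, submatrix_apply, Equiv.apply_symm_apply]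
  rw [← e.symm.sum_comp, Fintype.sum_prod_type, Finset.sum_eq_single i]
  · simp [kroneckerMap_apply]
  · intro i' _ hi
    simp [kroneckerMap_apply, Matrix.one_apply_ne hi]
  · simp

/-- Rotations preserve the mass of each pair, so after exchanging the sums every pair contributes
its mass at most four times. -/
theorem sum_balancedMass_pairRotation_le {N : ℕ} {δ : ℝ}
    (hδ : ∀ v : Fin 2 → ℂ, (Finset.univ.filter fun j : Fin N =>
        |Complex.normSq ((v ᵥ* curveRotation j) 0) - Complex.normSq ((v ᵥ* curveRotation j) 1)| <
          δ * (Complex.normSq (v 0) + Complex.normSq (v 1))).card ≤ 4)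
    {w : Fin d → ℂ} (hw : ∑ a, Complex.normSq (w a) = 1) :
    ∑ j : Fin N, balancedMass δ (fun x => Complex.normSq
      ((w ᵥ* (pairRotation e j : Matrix (Fin d) (Fin d) ℂ)) (e.symm x))) ≤ 4 := by
  simp only [balancedMass, vecMul_pairRotation]
  have hadd : ∀ (j : ℕ) (v : Fin 2 → ℂ), Complex.normSq ((v ᵥ* curveRotation j) 0) +
      Complex.normSq ((v ᵥ* curveRotation j) 1) = Complex.normSq (v 0) + Complex.normSq (v 1) :=
    fun j v => normSq_vecMul_rotation_add _ v
  simp only [hadd]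
  rw [Finset.sum_comm]
  calc _ ≤ ∑ i, 4 * (Complex.normSq (w (e.symm (i, 0))) +
        Complex.normSq (w (e.symm (i, 1)))) := by
        refine Finset.sum_le_sum fun i _ => ?_
        rw [← Finset.sum_filter, Finset.sum_const, nsmul_eq_mul]
        refine mul_le_mul_of_nonneg_right ?_
          (add_nonneg (Complex.normSq_nonneg _) (Complex.normSq_nonneg _))
        exact_mod_cast hδ fun l => w (e.symm (i, l))
    _ = 4 := by
        rw [← Finset.mul_sum]
        have : ∑ i, (Complex.normSq (w (e.symm (i, 0))) + Complex.normSq (w (e.symm (i, 1)))) =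
            1 := by
          rw [← hw, ← e.symm.sum_comp, Fintype.sum_prod_type]
          simp [Fin.sum_univ_two]
        rw [this, mul_one]

end pairRotation

/-! ### The quantum algorithm -/

instance (d : ℕ) : Measure.IsHaarMeasure (haarUnitary d) := by
  unfold haarUnitary
  infer_instance

/-- The Haar measure on the compact group `U(d)` is also right invariant. -/
instance (d : ℕ) : Measure.IsMulRightInvariant (haarUnitary d) where
  map_mul_right_eq_self g := by
    have hm : Measurable fun U : unitaryGroup (Fin d) ℂ => U * g :=
      (continuous_mul_const g).measurable
    have : IsProbabilityMeasure ((haarUnitary d).map (· * g)) :=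
      Measure.isProbabilityMeasure_map hm.aemeasurable
    -- The pushforward is still left invariant, so it is a multiple of Haar measure; comparing total
    -- masses gives the factor 1.
    have h := Measure.isMulInvariant_eq_smul_of_compactSpace ((haarUnitary d).map (· * g))
      (haarUnitary d)
    have h1 := congrArg (fun μ : Measure (unitaryGroup (Fin d) ℂ) => μ Set.univ) h
    rw [Measure.smul_apply, measure_univ, measure_univ] at h1
    rw [h]
    ext s _
    rw [Measure.smul_apply]
    simp only [ENNReal.smul_def, smul_eq_mul, mul_one] at h1 ⊢
    rw [← h1, one_mul]

theorem outputProb_basisTree {n : ℕ} (U : unitaryGroup (Fin (2 ^ n)) ℂ) (ρ : Op n) (b : Bool) :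
    ∀ {T : ℕ} (test : (Fin T → Fin (2 ^ n)) → Bool),
      (basisTree U test).outputProb ρ b = testProb (fun i => (basisPOVM U).prob ρ i) test b := by
  intro T
  induction T with
  | zero =>
    intro test
    simp only [testProb_eq_iidExp, iidExp, basisTree, LearningTree.outputProb]
    simp [Subsingleton.elim _ (Fin.elim0 : Fin 0 → Fin (2 ^ n))]
  | succ T ih =>
    intro test
    simp only [basisTree, LearningTree.outputProb, ih]
    simp only [testProb_eq_iidExp]
    rw [iidExp_succ]

theorem basisPOVM_prob_maximallyMixed {n : ℕ} (U : unitaryGroup (Fin (2 ^ n)) ℂ)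
    (i : Fin (2 ^ n)) :
    (basisPOVM U).prob (maximallyMixed n) i = 1 / ((2 ^ n : ℕ) : ℝ) := by
  have hcol : ∑ a, (U : Op n) a i * star ((U : Op n) a i) = 1 := by
    have h := congrFun (congrFun (mem_unitaryGroup_iff'.1 U.2) i) i
    rw [Matrix.mul_apply, Matrix.one_apply_eq] at h
    rw [← h]
    exact Finset.sum_congr rfl fun a _ => by rw [star_apply, mul_comm]
  have htr : (vecMulVec (fun a => (U : Op n) a i) (fun a => star ((U : Op n) a i))).trace = 1 := by
    rw [← hcol]; rfl
  simp only [POVM.prob, basisPOVM, maximallyMixed, Matrix.mul_smul, Matrix.mul_one, trace_smul, htr]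
  rw [smul_eq_mul, mul_one]
  have : ((2 : ℂ) ^ n)⁻¹ = ((1 / ((2 ^ n : ℕ) : ℝ) : ℝ) : ℂ) := by push_cast; simp
  rw [this, Complex.ofReal_re]

/-- Writing the amplitudes as a row vector times `U` makes right multiplication of `U` by a block
rotation act on the amplitudes pair by pair. -/
theorem basisPOVM_prob_pure {n : ℕ} (U : unitaryGroup (Fin (2 ^ n)) ℂ) (ψ : Fin (2 ^ n) → ℂ)
    (i : Fin (2 ^ n)) :
    (basisPOVM U).prob (vecMulVec ψ fun a => star (ψ a)) i =
      Complex.normSq (((fun a => star (ψ a)) ᵥ* (U : Op n)) i) := by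
  have h : (vecMulVec (fun a => (U : Op n) a i) (fun a => star ((U : Op n) a i)) *
      vecMulVec ψ fun a => star (ψ a)).trace =
        (∑ a, star (ψ a) * (U : Op n) a i) * star (∑ a, star (ψ a) * (U : Op n) a i) := by
    rw [vecMulVec_mul_vecMulVec, trace_vecMulVec, dotProduct_smul, smul_eq_mul, mul_comm,
      star_sum]
    simp only [dotProduct, star_mul', star_star]
    congr 1 <;> exact Finset.sum_congr rfl fun _ _ => mul_comm _ _
  simp only [POVM.prob, basisPOVM, h, vecMul, dotProduct]
  rw [show star (∑ a, star (ψ a) * (U : Op n) a i) =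
    (starRingEnd ℂ) (∑ a, star (ψ a) * (U : Op n) a i) from rfl, Complex.mul_conj,
    Complex.ofReal_re]

theorem sum_normSq_vecMul {d : ℕ} (U : unitaryGroup (Fin d) ℂ) (w : Fin d → ℂ) :
    ∑ i, Complex.normSq ((w ᵥ* (U : Matrix (Fin d) (Fin d) ℂ)) i) =
      ∑ i, Complex.normSq (w i) := by
  have hn : ∀ v : Fin d → ℂ, ((∑ i, Complex.normSq (v i) : ℝ) : ℂ) = v ⬝ᵥ star v := fun v => by
    push_cast
    exact Finset.sum_congr rfl fun i _ => (Complex.mul_conj _).symm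
  have hU : (U : Matrix (Fin d) (Fin d) ℂ) * (U : Matrix (Fin d) (Fin d) ℂ)ᴴ = 1 :=
    mem_unitaryGroup_iff.1 U.2
  apply Complex.ofReal_injective
  rw [hn, hn, star_vecMul, dotProduct_mulVec, vecMul_vecMul, hU, vecMul_one]

theorem outputProb_haarBasisAlgorithm {n T : ℕ} (test : (Fin T → Fin (2 ^ n)) → Bool) (ρ : Op n)
    (b : Bool) : (haarBasisAlgorithm test).outputProb ρ b =
      ∫ U, (basisTree U test).outputProb ρ b ∂haarUnitary (2 ^ n) := rfl

theorem integrable_outputProb_basisTree {n T : ℕ} (test : (Fin T → Fin (2 ^ n)) → Bool) (ρ : Op n)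
    (b : Bool) : Integrable (fun U => (basisTree U test).outputProb ρ b) (haarUnitary (2 ^ n)) :=
  (continuous_outputProb_basisTree ρ b test).integrable_of_hasCompactSupport
    (HasCompactSupport.of_compactSpace _)

/-- A lower bound for the average over finitely many right translates bounds the Haar average. -/
theorem le_integral_haarUnitary_of_le_sum {d N : ℕ} {f : unitaryGroup (Fin d) ℂ → ℝ}
    (hf : Integrable f (haarUnitary d)) (V : Fin N → unitaryGroup (Fin d) ℂ) {c : ℝ}
    (h : ∀ U, N * c ≤ ∑ j, f (U * V j)) (hN : 0 < N) : c ≤ ∫ U, f U ∂haarUnitary d := by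
  have h1 : ∫ U, ∑ j, f (U * V j) ∂haarUnitary d = N * ∫ U, f U ∂haarUnitary d := by
    rw [integral_finsetSum _ fun j _ => hf.comp_mul_right (V j)]
    simp [integral_mul_right_eq_self]
  have h2 : N * c ≤ ∫ U, ∑ j, f (U * V j) ∂haarUnitary d := by
    calc N * c = ∫ _, N * c ∂haarUnitary d := by simp
      _ ≤ _ := integral_mono (integrable_const _)
        (integrable_finsetSum _ fun j _ => hf.comp_mul_right (V j)) h
  rw [h1] at h2
  exact le_of_mul_le_mul_left h2 (by exact_mod_cast hN)

theorem outputProb_haarBasisAlgorithm_mixed {n T : ℕ} (test : (Fin T → Fin (2 ^ n)) → Bool)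
    (b : Bool) : (haarBasisAlgorithm test).outputProb (maximallyMixed n) b =
      testProb (fun _ => 1 / ((2 ^ n : ℕ) : ℝ)) test b := by
  rw [outputProb_haarBasisAlgorithm]
  simp only [outputProb_basisTree, basisPOVM_prob_maximallyMixed]
  simp

/-- A bound linear in the balanced mass can be averaged over the rotations; it is trivial when the
mass is at least $1/2$. Since $d = 2|\iota|$, the distance bound $\delta^2/(8|\iota|)$ equals
$(\delta/2)^2/d$, whence the parameter $\delta/2$. -/
theorem le_testProb_of_balancedMass {d T : ℕ} {ι : Type*} [Fintype ι] (e : Fin d ≃ ι × Fin 2)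
    (hd : 0 < d) {δ : ℝ} (hδ : 0 < δ) {test : (Fin T → Fin d) → Bool}
    (htest : IsL2UniformityTester (δ / 2) test) {q : Fin d → ℝ} (hq : q ∈ stdSimplex ℝ (Fin d)) :
    9 / 10 * (1 - 2 * balancedMass δ fun x => q (e.symm x)) ≤ testProb q test false := by
  have hnonneg : 0 ≤ balancedMass δ fun x => q (e.symm x) :=
    balancedMass_nonneg δ fun _ => hq.1 _
  by_cases hb : balancedMass δ (fun x => q (e.symm x)) < 1 / 2
  · have hcard : d = Fintype.card ι * 2 := by
      simpa using Fintype.card_congr e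
    have : Nonempty ι := Fintype.card_pos_iff.1 (by omega)
    have hdR : (d : ℝ) = 2 * Fintype.card ι := by rw [hcard]; push_cast; ring
    have hd0 : (0 : ℝ) < d := by exact_mod_cast hd
    have h := sum_sq_sub_ge_of_balancedMass_lt hδ (q := fun x => q (e.symm x)) (fun _ => hq.1 _)
      (by rw [e.symm.sum_comp q]; exact hq.2) hb
    rw [e.symm.sum_comp fun a => (q a - 1 / (2 * Fintype.card ι : ℝ)) ^ 2, ← hdR] at h
    have h2 : δ / 2 / √(d : ℝ) ≤ √(∑ i, (q i - 1 / (d : ℝ)) ^ 2) := by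
      refine Real.le_sqrt_of_sq_le (le_trans (le_of_eq ?_) h)
      rw [div_pow, Real.sq_sqrt hd0.le, show (8 * Fintype.card ι : ℝ) = 4 * d by rw [hdR]; ring]
      field_simp
      norm_num
    linarith [htest.2 q hq h2]
  · linarith [testProb_nonneg hq.1 test false]

theorem le_outputProb_haarBasisAlgorithm_pure {n T : ℕ} {ι : Type*} [Fintype ι] [DecidableEq ι]
    (e : Fin (2 ^ n) ≃ ι × Fin 2) {δ : ℝ} (hδ : 0 < δ)
    (hbal : ∀ v : Fin 2 → ℂ, (Finset.univ.filter fun j : Fin 72 =>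
        |Complex.normSq ((v ᵥ* curveRotation j) 0) - Complex.normSq ((v ᵥ* curveRotation j) 1)| <
          δ * (Complex.normSq (v 0) + Complex.normSq (v 1))).card ≤ 4)
    {test : (Fin T → Fin (2 ^ n)) → Bool} (htest : IsL2UniformityTester (δ / 2) test) {ρ : Op n}
    (hρ : IsPureState ρ) : 4 / 5 ≤ (haarBasisAlgorithm test).outputProb ρ false := by
  obtain ⟨ψ, hψ, rfl⟩ := hρ
  have hψ1 : ∑ a, Complex.normSq (star (ψ a)) = 1 := by
    have h := EuclideanSpace.norm_sq_eq ψ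
    rw [hψ, one_pow] at h
    rw [h]
    exact Finset.sum_congr rfl fun a _ => by
      rw [Complex.normSq_eq_norm_sq, norm_star]
  rw [outputProb_haarBasisAlgorithm]
  refine le_integral_haarUnitary_of_le_sum (integrable_outputProb_basisTree _ _ _)
    (fun j : Fin 72 => pairRotation e j) (fun U => ?_) (by norm_num)
  set w : Fin (2 ^ n) → ℂ := (fun a => star (ψ a)) ᵥ* (U : Op n) with hw
  have hw1 : ∑ a, Complex.normSq (w a) = 1 := by rw [hw, sum_normSq_vecMul, hψ1]
  have hsum := sum_balancedMass_pairRotation_le e hbal hw1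
  have hterm : ∀ j : Fin 72, 9 / 10 * (1 - 2 * balancedMass δ fun x => Complex.normSq
      ((w ᵥ* (pairRotation e j : Op n)) (e.symm x))) ≤
        (basisTree (U * pairRotation e j) test).outputProb
          (vecMulVec (fun a => ψ a) fun a => star (ψ a)) false := fun j => by
    rw [outputProb_basisTree]
    simp only [basisPOVM_prob_pure, Submonoid.coe_mul, ← vecMul_vecMul]
    refine le_testProb_of_balancedMass e (by positivity) hδ htest
      (q := fun i => Complex.normSq ((w ᵥ* (pairRotation e j : Op n)) i))
      ⟨fun _ => Complex.normSq_nonneg _, ?_⟩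
    rw [sum_normSq_vecMul, hw1]
  -- The number 72 is exactly what is needed: $\frac{9}{10}(72 - 2\cdot 4) = 72\cdot\frac45$.
  refine le_trans ?_ (Finset.sum_le_sum fun j _ => hterm j)
  rw [← Finset.mul_sum, Finset.sum_sub_distrib, ← Finset.mul_sum]
  simp only [Finset.sum_const, Finset.card_univ, Fintype.card_fin, nsmul_eq_mul]
  push_cast
  linarith

end PurityTesting

end

theorem mainTheorem10 :
    ∃ C : ℝ, 0 < C ∧ ∃ ε : ℝ, 0 < ε ∧ ε < 1 ∧
      ∀ n : ℕ, 1 ≤ n →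
        ∃ T : ℕ, (T : ℝ) ≤ C * (2 : ℝ) ^ ((n : ℝ) / 2) ∧
          ∃ test : (Fin T → Fin (2 ^ n)) → Bool,
            PurityTesting.IsL2UniformityTester ε test ∧
              (PurityTesting.haarBasisAlgorithm test).DistinguishesPureFromMixed (4 / 5) := by
  obtain ⟨δ, hδ, hδ1, hbal⟩ := PurityTesting.exists_card_curveRotation_balanced_le 72
  have hε : 0 < δ / 2 := by positivity
  -- The factor 2 accounts for the two halves of the sample, and the $+1$ absorbs rounding up, since
  -- $\sqrt d \ge 1$.
  refine ⟨2 * (200 / (δ / 2) ^ 2 + 1), by positivity, δ / 2, hε, by linarith, fun n hn => ?_⟩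
  -- Having $n \ge 1$ makes $2^n$ even, so the outcomes can be paired.
  obtain ⟨k, rfl⟩ : ∃ k, n = k + 1 := ⟨n - 1, by omega⟩
  have hsqrt : √((2 ^ (k + 1) : ℕ) : ℝ) = (2 : ℝ) ^ (((k + 1 : ℕ) : ℝ) / 2) := by
    rw [Real.sqrt_eq_rpow, Nat.cast_pow, ← Real.rpow_natCast, Nat.cast_ofNat,
      ← Real.rpow_mul (by norm_num)]
    congr 1
    ring
  have hone : 1 ≤ √((2 ^ (k + 1) : ℕ) : ℝ) :=
    Real.one_le_sqrt.2 (by exact_mod_cast Nat.one_le_two_pow)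
  set m := ⌈200 / (δ / 2) ^ 2 * √((2 ^ (k + 1) : ℕ) : ℝ)⌉₊ with hm
  have htest := PurityTesting.isL2UniformityTester_collisionTest (d := 2 ^ (k + 1)) (m := m)
    (by positivity) hε (by linarith) (Nat.le_ceil _)
  refine ⟨m + m, ?_, PurityTesting.collisionTest (δ / 2), htest, ?_, fun ρ hρ => ?_⟩
  · rw [← hsqrt]
    have h := (Nat.ceil_lt_add_one
      (by positivity : 0 ≤ 200 / (δ / 2) ^ 2 * √((2 ^ (k + 1) : ℕ) : ℝ))).le
    rw [← hm] at h
    rw [Nat.cast_add]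
    linarith
  · rw [PurityTesting.outputProb_haarBasisAlgorithm_mixed]
    exact le_trans (by norm_num) htest.1
  · exact PurityTesting.le_outputProb_haarBasisAlgorithm_pure
      ((finCongr (pow_succ 2 k)).trans finProdFinEquiv.symm) hδ hbal htest hρ
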